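/- Let $b,c\in\mathbb{R}$ with $c\neq 0$, and let $h:\mathbb{R}\to\mathbb{R}$ be continuous. For $s>0$ put $\|h\|_s=\sup_{x\in[-s,s]}|h(x)|$, and let $$U=\left\{b'\in(-2,2)\;:\;\arccos\left(-\tfrac{b'}{2}\right)=\tfrac{2\pi k}{j}\text{ for some } k,j\in\mathbb{N}\text{ with }0\le 2k<j\right\}.$$ Suppose that: 1. $\displaystyle\lim_{r\to\infty}\frac{\|h\|_{2r}}{r}=0$; 2. there exists $R>0$ such that $x\,h(x)>0$ whenever $|x|>R$; 3. $b\in\mathbb{R}\setminus U$ or $c\neq 1$. Then for every odd integer $N>1$ the difference equation $$y(t+2)+b\,y(t+1)+c\,y(t)=h(y(t)),\qquad t=0,1,2,\dots,$$ has an $N$-periodic solution, that is, a real solution $y$ with $y(t+N)=y(t)$ for all integers $t\ge 0$. -/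

import Mathlib

namespace PeriodicDifference

/-- The quantity `‖h‖_s = sup_{x ∈ [-s, s]} |h x|`. -/
noncomputable def supAbs (h : ℝ → ℝ) (s : ℝ) : ℝ :=
  sSup ((fun x : ℝ => |h x|) '' Set.Icc (-s) s)

/-- The set of angles `2πk/j` with `k, j` natural numbers and `0 ≤ 2k < j`. -/
def angleSet : Set ℝ :=
  {θ : ℝ | ∃ k j : ℕ, 2 * k < j ∧ θ = 2 * Real.pi * (k : ℝ) / (j : ℝ)}

/-- The set `U` of all `b ∈ (-2, 2)` with `arccos (-b/2)` in `angleSet`. -/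
def resonantSet : Set ℝ :=
  {b : ℝ | b ∈ Set.Ioo (-2 : ℝ) 2 ∧ Real.arccos (-b / 2) ∈ angleSet}

/-- `y` solves `y(t+2) + b y(t+1) + c y(t) = h(y(t))` for all integers `t ≥ 0`. -/
def IsSolution (b c : ℝ) (h : ℝ → ℝ) (y : ℕ → ℝ) : Prop :=
  ∀ t : ℕ, y (t + 2) + b * y (t + 1) + c * y t = h (y t)

end PeriodicDifference

/-!
A solution is determined by `z = (y 0, y 1)`, and it is `N`-periodic as soon as
`(y N, y (N + 1)) = z`. Periodicity is thus a system of two equations in the plane, for which the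
two-dimensional Poincaré–Miranda theorem `exists_common_zero_of_sign_change` suffices. That theorem
follows from the existence of continuous logarithms of nonvanishing functions on the plane.

The growth hypothesis makes `h` sublinear, so over `N + 1` steps the orbit differs from the orbit of
the linear recurrence only by a sublinear function of `z` (`sublinear_orbit_sub_linOrbit`).

* If `1 + b + c ≠ 0`, then no root of `x ^ 2 + b x + c` is an `N`-th root of unity: `1` is excluded
  by assumption, `-1` because `N` is odd, and a nonreal one would give `c = 1` and `b` in the
  resonant set. Hence the linear part of the periodicity equations is invertible, and the whole
  system is equivalent to the vanishing of a sublinear perturbation of the identity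
  (`exists_periodic_of_nonresonant`).
* If `1 + b + c = 0`, then `y (t + 1) - c y t` increases by `h (y t)` at each step, so periodicity
  is equivalent to `∑ h (y t) = 0` over a period together with `y N = y 0`. On a flat and large
  rectangle in the coordinates `y 0` and `y 1 - y 0`, the sign condition on `h` controls the first
  quantity on the vertical sides, and positivity of `1 + c + ⋯ + c ^ (N - 1)` for odd `N` controls
  the second on the horizontal sides (`exists_periodic_of_resonant`).
-/

namespace PeriodicDifference

/-! ### A planar intermediate value theorem -/

/-- On a connected set where `μ * exp ∘ G` stays in the right half-plane, `G` and the principal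
logarithm of `μ * exp ∘ G` differ by a constant. -/
theorem sub_log_eq_of_isPreconnected {X : Type*} [TopologicalSpace X] {G : X → ℂ}
    (hG : Continuous G) {S : Set X} (hS : IsPreconnected S) (μ : ℂ)
    (hμ : ∀ p ∈ S, 0 < (μ * Complex.exp (G p)).re) {p q : X} (hp : p ∈ S) (hq : q ∈ S) :
    G p - Complex.log (μ * Complex.exp (G p)) = G q - Complex.log (μ * Complex.exp (G q)) := by
  have hμ0 : μ ≠ 0 := by
    rintro rfl
    simpa using hμ p hp
  have hdisc : IsDiscrete
      ((AddSubgroup.zmultiples (2 * Real.pi * Complex.I) : AddSubgroup ℂ) : Set ℂ) :=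
    ⟨NormedSpace.discreteTopology_zmultiples _⟩
  have hcont : ContinuousOn
      (fun p => G p - Complex.log (μ * Complex.exp (G p)) + Complex.log μ) S := by
    refine (hG.continuousOn.sub (ContinuousOn.clog (by fun_prop) fun x hx => ?_)).add
      continuousOn_const
    exact Complex.mem_slitPlane_iff.2 (Or.inl (hμ x hx))
  have hmaps : Set.MapsTo (fun p => G p - Complex.log (μ * Complex.exp (G p)) + Complex.log μ) S
      ((AddSubgroup.zmultiples (2 * Real.pi * Complex.I) : AddSubgroup ℂ) : Set ℂ) := by
    intro x _
    have h1 : Complex.exp (G x - Complex.log (μ * Complex.exp (G x)) + Complex.log μ) = 1 := by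
      rw [Complex.exp_add, Complex.exp_sub, Complex.exp_log (mul_ne_zero hμ0 (Complex.exp_ne_zero _)),
        Complex.exp_log hμ0]
      have := Complex.exp_ne_zero (G x)
      field_simp
    obtain ⟨n, hn⟩ := Complex.exp_eq_one_iff.1 h1
    refine AddSubgroup.mem_zmultiples_iff.2 ⟨n, ?_⟩
    simp only [hn, zsmul_eq_mul]
  have := hS.constant_of_mapsTo hdisc hcont hmaps hp hq
  simpa using this

theorem log_sub_log_neg_I_mul {u : ℂ} (hre : 0 < u.re) (him : 0 < u.im) :
    Complex.log u - Complex.log (-Complex.I * u) = Real.pi / 2 * Complex.I := by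
  have hu : u ≠ 0 := by
    rintro rfl
    simp at hre
  have harg := Complex.arg_mem_Ioc u
  have h0 : 0 ≤ u.arg := Complex.arg_nonneg_iff.2 him.le
  have hlog : Complex.log (-Complex.I * u) = Complex.log (-Complex.I) + Complex.log u := by
    refine Complex.log_mul (by simp) hu ?_
    rw [Complex.arg_neg_I]
    constructor <;> linarith [harg.1, harg.2, Real.pi_pos]
  rw [hlog, Complex.log_neg_I]
  ring

/-- A form of the **Poincaré–Miranda theorem** in the plane: if `f` is positive on the right side
and negative on the left side of a rectangle, and `g` is positive on the top side and negative on
the bottom side, then `f` and `g` have a common zero (not asserted to lie in the rectangle).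
Otherwise `f + i g` would have a continuous logarithm on the plane, whereas its argument increases
by `2π` along the boundary of the rectangle. -/
theorem exists_common_zero_of_sign_change {a b : ℝ} (ha : 0 < a) (hb : 0 < b) {f g : ℝ × ℝ → ℝ}
    (hf : Continuous f) (hg : Continuous g)
    (hf_right : ∀ y ∈ Set.Icc (-b) b, 0 < f (a, y))
    (hf_left : ∀ y ∈ Set.Icc (-b) b, f (-a, y) < 0)
    (hg_top : ∀ x ∈ Set.Icc (-a) a, 0 < g (x, b))
    (hg_bot : ∀ x ∈ Set.Icc (-a) a, g (x, -b) < 0) :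
    ∃ p : ℝ × ℝ, f p = 0 ∧ g p = 0 := by
  by_contra! hne
  let F : C(ℝ × ℝ, ℂ) := ⟨fun p => f p + g p * Complex.I, by fun_prop⟩
  have hF : ∀ p, F p ∈ ({0}ᶜ : Set ℂ) := by
    intro p hp
    have hp : (f p + g p * Complex.I : ℂ) = 0 := hp
    have h1 := congrArg Complex.re hp
    have h2 := congrArg Complex.im hp
    simp at h1 h2
    exact hne p h1 h2
  obtain ⟨G, ⟨-, hG⟩, -⟩ := Complex.isCoveringMapOn_exp.existsUnique_continuousMap_lifts F
    (a₀ := (0, 0)) (Complex.exp_log (hF (0, 0))) hF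
  have hG : ∀ p, Complex.exp (G p) = f p + g p * Complex.I := fun p => congrFun hG p
  have hA : a ∈ Set.Icc (-a) a := ⟨by linarith, le_rfl⟩
  have hA' : -a ∈ Set.Icc (-a) a := ⟨le_rfl, by linarith⟩
  have hB : b ∈ Set.Icc (-b) b := ⟨by linarith, le_rfl⟩
  have hB' : -b ∈ Set.Icc (-b) b := ⟨le_rfl, by linarith⟩
  have hvert : ∀ x : ℝ, IsPreconnected ((fun y : ℝ => (x, y)) '' Set.Icc (-b) b) := fun x =>
    isPreconnected_Icc.image _ (by fun_prop)
  have hhor : ∀ y : ℝ, IsPreconnected ((fun x : ℝ => (x, y)) '' Set.Icc (-a) a) := fun y =>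
    isPreconnected_Icc.image _ (by fun_prop)
  have right := sub_log_eq_of_isPreconnected G.continuous (hvert a) 1
    (by rintro _ ⟨y, hy, rfl⟩; simpa [hG] using hf_right y hy)
    ⟨b, hB, rfl⟩ ⟨-b, hB', rfl⟩
  have top := sub_log_eq_of_isPreconnected G.continuous (hhor b) (-Complex.I)
    (by rintro _ ⟨x, hx, rfl⟩; simpa [hG] using hg_top x hx)
    ⟨a, hA, rfl⟩ ⟨-a, hA', rfl⟩
  have left := sub_log_eq_of_isPreconnected G.continuous (hvert (-a)) (-1)
    (by rintro _ ⟨y, hy, rfl⟩; simpa [hG] using hf_left y hy)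
    ⟨b, hB, rfl⟩ ⟨-b, hB', rfl⟩
  have bot := sub_log_eq_of_isPreconnected G.continuous (hhor (-b)) Complex.I
    (by rintro _ ⟨x, hx, rfl⟩; simpa [hG] using hg_bot x hx)
    ⟨a, hA, rfl⟩ ⟨-a, hA', rfl⟩
  have c1 := log_sub_log_neg_I_mul (u := 1 * Complex.exp (G (a, b)))
    (by simpa [hG] using hf_right b hB) (by simpa [hG] using hg_top a hA)
  have c2 := log_sub_log_neg_I_mul (u := -Complex.I * Complex.exp (G (-a, b)))
    (by simpa [hG] using hg_top (-a) hA') (by simpa [hG] using hf_left b hB)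
  have c3 := log_sub_log_neg_I_mul (u := -1 * Complex.exp (G (-a, -b)))
    (by simpa [hG] using hf_left (-b) hB') (by simpa [hG] using hg_bot (-a) hA')
  have c4 := log_sub_log_neg_I_mul (u := Complex.I * Complex.exp (G (a, -b)))
    (by simpa [hG] using hg_bot a hA) (by simpa [hG] using hf_right (-b) hB')
  have e2 : -Complex.I * (-Complex.I * Complex.exp (G (-a, b))) =
      -1 * Complex.exp (G (-a, b)) := by
    linear_combination Complex.exp (G (-a, b)) * Complex.I_mul_I
  have e3 : -Complex.I * (-1 * Complex.exp (G (-a, -b))) =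
      Complex.I * Complex.exp (G (-a, -b)) := by ring
  have e4 : -Complex.I * (Complex.I * Complex.exp (G (a, -b))) =
      1 * Complex.exp (G (a, -b)) := by
    linear_combination -Complex.exp (G (a, -b)) * Complex.I_mul_I
  rw [e2] at c2
  rw [e3] at c3
  rw [e4] at c4
  rw [one_mul (Complex.exp (G (a, b)))] at c1 right
  -- Going once round the boundary, the four edge identities and the four corner identities add up
  -- to `0 = 2πi`.
  have hsum : (Real.pi : ℂ) * Complex.I = 0 := by
    linear_combination (-1 / 2 : ℂ) * (c1 + c2 + c3 + c4 + right - top - left + bot)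
  simp [Real.pi_ne_zero] at hsum

/-! ### Sublinear functions -/

/-- `f z = o(‖z‖)` as `‖z‖ → ∞`, together with boundedness on bounded sets: for every `ε > 0`,
`f` is bounded by `ε * ‖z‖` up to an additive constant. -/
def Sublinear {E : Type*} [NormedAddCommGroup E] (f : E → ℝ) : Prop :=
  ∀ ε : ℝ, 0 < ε → ∃ K : ℝ, ∀ z, |f z| ≤ ε * ‖z‖ + K

namespace Sublinear

variable {E : Type*} [NormedAddCommGroup E] {f g : E → ℝ}

theorem zero : Sublinear (fun _ : E => (0 : ℝ)) := fun ε hε => ⟨0, fun z => by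
  rw [abs_zero, add_zero]
  positivity⟩

theorem add (hf : Sublinear f) (hg : Sublinear g) : Sublinear (fun z => f z + g z) := by
  intro ε hε
  obtain ⟨K, hK⟩ := hf (ε / 2) (by positivity)
  obtain ⟨L, hL⟩ := hg (ε / 2) (by positivity)
  refine ⟨K + L, fun z => (abs_add_le _ _).trans ?_⟩
  linarith [hK z, hL z]

theorem const_mul (a : ℝ) (hf : Sublinear f) : Sublinear (fun z => a * f z) := by
  intro ε hε
  obtain ⟨K, hK⟩ := hf (ε / (|a| + 1)) (by positivity)
  refine ⟨|a| * K, fun z => ?_⟩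
  have h1 : |a| * (ε / (|a| + 1)) ≤ ε := by
    rw [mul_div_assoc', div_le_iff₀ (by positivity)]
    nlinarith [abs_nonneg a]
  calc |a * f z| = |a| * |f z| := abs_mul _ _
    _ ≤ |a| * (ε / (|a| + 1) * ‖z‖ + K) := by gcongr; exact hK z
    _ = |a| * (ε / (|a| + 1)) * ‖z‖ + |a| * K := by ring
    _ ≤ ε * ‖z‖ + |a| * K := by gcongr

theorem comp {h : ℝ → ℝ} (hh : Sublinear h) {C K : ℝ} (hf : ∀ z, |f z| ≤ C * ‖z‖ + K) :
    Sublinear (fun z => h (f z)) := by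
  intro ε hε
  obtain ⟨L, hL⟩ := hh (ε / (|C| + 1)) (by positivity)
  refine ⟨ε / (|C| + 1) * K + L, fun z => ?_⟩
  have h1 : ε / (|C| + 1) * C ≤ ε := by
    rw [div_mul_eq_mul_div, div_le_iff₀ (by positivity)]
    nlinarith [le_abs_self C]
  calc |h (f z)| ≤ ε / (|C| + 1) * |f z| + L := hL _
    _ ≤ ε / (|C| + 1) * (C * ‖z‖ + K) + L := by gcongr; exact hf z
    _ = ε / (|C| + 1) * C * ‖z‖ + (ε / (|C| + 1) * K + L) := by ring
    _ ≤ ε * ‖z‖ + (ε / (|C| + 1) * K + L) := by gcongr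

end Sublinear

theorem sublinear_of_tendsto_supAbs {h : ℝ → ℝ} (hcont : Continuous h)
    (hgrowth : Filter.Tendsto (fun r : ℝ => supAbs h (2 * r) / r) Filter.atTop (nhds 0)) :
    Sublinear h := by
  intro ε hε
  obtain ⟨r₀, hr₀⟩ := Filter.eventually_atTop.1 (hgrowth.eventually (gt_mem_nhds hε))
  refine ⟨ε * max r₀ 1, fun x => ?_⟩
  set r := max |x| (max r₀ 1) with hr
  have hr1 : 1 ≤ r := (le_max_right _ _).trans (le_max_right _ _)
  have hxr : |x| ≤ r := le_max_left _ _
  have hsup : supAbs h (2 * r) / r < ε := hr₀ r ((le_max_left _ _).trans (le_max_right _ _))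
  have hbdd : BddAbove ((fun x : ℝ => |h x|) '' Set.Icc (-(2 * r)) (2 * r)) :=
    (isCompact_Icc.image hcont.abs).bddAbove
  have hle : |h x| ≤ supAbs h (2 * r) :=
    le_csSup hbdd ⟨x, abs_le.1 (by linarith), rfl⟩
  have h0 : (0 : ℝ) < max r₀ 1 := lt_max_of_lt_right one_pos
  rw [div_lt_iff₀ (by linarith)] at hsup
  calc |h x| ≤ ε * r := by linarith
    _ ≤ ε * (|x| + max r₀ 1) := by
      gcongr
      exact max_le (by linarith) (by linarith [abs_nonneg x])
    _ = ε * ‖x‖ + ε * max r₀ 1 := by rw [Real.norm_eq_abs]; ring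

/-! ### Orbits and their linear parts -/

/-- The solution `y` of `y(t+2) + b y(t+1) + c y(t) = h(y(t))` with `(y 0, y 1) = z`. -/
def orbit (b c : ℝ) (h : ℝ → ℝ) (z : ℝ × ℝ) : ℕ → ℝ
  | 0 => z.1
  | 1 => z.2
  | t + 2 => h (orbit b c h z t) - b * orbit b c h z (t + 1) - c * orbit b c h z t

/-- The solution at time `t` of `y(t+2) + b y(t+1) + c y(t) = 0`, as a linear function of the
initial values `(y 0, y 1)`. -/
noncomputable def linOrbit (b c : ℝ) : ℕ → (ℝ × ℝ →L[ℝ] ℝ)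
  | 0 => ContinuousLinearMap.fst ℝ ℝ ℝ
  | 1 => ContinuousLinearMap.snd ℝ ℝ ℝ
  | t + 2 => -(b • linOrbit b c (t + 1)) - c • linOrbit b c t

section Orbit

variable {b c : ℝ} {h : ℝ → ℝ}

@[simp] theorem orbit_zero (z : ℝ × ℝ) : orbit b c h z 0 = z.1 := rfl

@[simp] theorem orbit_one (z : ℝ × ℝ) : orbit b c h z 1 = z.2 := rfl

theorem orbit_add_two (z : ℝ × ℝ) (t : ℕ) : orbit b c h z (t + 2) =
    h (orbit b c h z t) - b * orbit b c h z (t + 1) - c * orbit b c h z t := rfl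

@[simp] theorem linOrbit_zero (z : ℝ × ℝ) : linOrbit b c 0 z = z.1 := rfl

@[simp] theorem linOrbit_one (z : ℝ × ℝ) : linOrbit b c 1 z = z.2 := rfl

theorem linOrbit_add_two (z : ℝ × ℝ) (t : ℕ) : linOrbit b c (t + 2) z =
    -(b * linOrbit b c (t + 1) z) - c * linOrbit b c t z := rfl

theorem isSolution_orbit (z : ℝ × ℝ) : IsSolution b c h (orbit b c h z) := by
  intro t
  rw [orbit_add_two]
  ring

theorem periodic_orbit {z : ℝ × ℝ} {N : ℕ} (h0 : orbit b c h z N = orbit b c h z 0)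
    (h1 : orbit b c h z (N + 1) = orbit b c h z 1) : Function.Periodic (orbit b c h z) N := by
  have key : ∀ t, orbit b c h z (t + N) = orbit b c h z t ∧
      orbit b c h z (t + 1 + N) = orbit b c h z (t + 1) := by
    intro t
    induction t with
    | zero => exact ⟨by rw [zero_add, h0], by rw [zero_add, add_comm, h1]⟩
    | succ t ih =>
      refine ⟨ih.2, ?_⟩
      rw [show t + 1 + 1 + N = (t + N) + 2 by ring, orbit_add_two, ih.1,
        show t + N + 1 = t + 1 + N by ring, ih.2, ← orbit_add_two]
  exact fun t => (key t).1

theorem continuous_orbit (hcont : Continuous h) (t : ℕ) :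
    Continuous (fun z => orbit b c h z t) := by
  induction t using Nat.twoStepInduction with
  | zero => exact continuous_fst
  | one => exact continuous_snd
  | more t ih0 ih1 =>
    simp only [orbit_add_two]
    fun_prop

/-- Over a fixed number of steps, a sublinear forcing term perturbs the linear recurrence only
sublinearly in the initial values. -/
theorem sublinear_orbit_sub_linOrbit (hh : Sublinear h) (t : ℕ) :
    Sublinear (fun z => orbit b c h z t - linOrbit b c t z) := by
  induction t using Nat.twoStepInduction with
  | zero => simpa using Sublinear.zero
  | one => simpa using Sublinear.zero
  | more t ih0 ih1 =>
    obtain ⟨K, hK⟩ := ih0 1 one_pos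
    have hbound : ∀ z : ℝ × ℝ, |orbit b c h z t| ≤ (1 + ‖linOrbit b c t‖) * ‖z‖ + K := by
      intro z
      have h1 := hK z
      have h2 := (linOrbit b c t).le_opNorm z
      rw [Real.norm_eq_abs] at h2
      have h3 := abs_add_le (orbit b c h z t - linOrbit b c t z) (linOrbit b c t z)
      rw [sub_add_cancel] at h3
      linarith
    have key := ((hh.comp hbound).add (ih1.const_mul (-b))).add (ih0.const_mul (-c))
    convert key using 2 with z
    rw [orbit_add_two, linOrbit_add_two]
    ring

end Orbit

/-! ### The nonresonant case -/

/-- An `N`-th root of unity, `N` odd, that solves `z ^ 2 + b z + c = 0` is either `1` or one of a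
pair of conjugate nonreal numbers `exp (± i θ)`; the latter forces `c = 1` and `b = -2 cos θ`. -/
theorem pow_ne_one_of_quadratic_eq_zero {b c : ℝ} (hres : b ∉ resonantSet ∨ c ≠ 1)
    (h1 : 1 + b + c ≠ 0) {N : ℕ} (hN : Odd N) {z : ℂ} (hz : z ^ 2 + b * z + c = 0) :
    z ^ N ≠ 1 := by
  intro hzN
  have hN0 : N ≠ 0 := by rintro rfl; simp at hN
  have hnorm : ‖z‖ = 1 := Complex.norm_eq_one_of_pow_eq_one hzN hN0
  have hsq : z.re ^ 2 + z.im ^ 2 = 1 := by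
    have := Complex.sq_norm z
    rw [hnorm, Complex.normSq_apply] at this
    linarith
  have hre : z.re ^ 2 - z.im ^ 2 + b * z.re + c = 0 := by
    have := congrArg Complex.re hz
    simp [pow_two] at this
    linarith
  have him : (2 * z.re + b) * z.im = 0 := by
    have := congrArg Complex.im hz
    simp [pow_two] at this
    linarith
  by_cases him0 : z.im = 0
  · have hzre : z = (z.re : ℂ) := Complex.ext rfl (by simp [him0])
    rw [him0] at hsq hre
    rcases sq_eq_one_iff.1 (show z.re ^ 2 = 1 by linarith) with h | h
    · rw [h] at hre
      exact h1 (by linarith)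
    · rw [hzre, h, Complex.ofReal_neg, Complex.ofReal_one, hN.neg_one_pow] at hzN
      norm_num at hzN
  · have hb := (mul_eq_zero.1 him).resolve_right him0
    have hc : c = 1 := by linear_combination hre - z.re * hb + hsq
    have hre1 : z.re ^ 2 < 1 := by
      have : 0 < z.im ^ 2 := by positivity
      linarith
    have hab := abs_lt.1 ((sq_lt_one_iff_abs_lt_one _).1 hre1)
    refine hres.elim (fun hb' => hb' ⟨⟨by linarith, by linarith⟩, ?_⟩) (fun hc' => hc' hc)
    rw [show -b / 2 = z.re by linarith]
    have : NeZero N := ⟨hN0⟩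
    obtain ⟨k, hk, hkz⟩ := (Complex.isPrimitiveRoot_exp N hN0).eq_pow_of_pow_eq_one hzN
    have hcos : z.re = Real.cos (2 * Real.pi * k / N) := by
      rw [← hkz, ← Complex.exp_nat_mul,
        show (k : ℂ) * (2 * Real.pi * Complex.I / N) =
          ((2 * Real.pi * k / N : ℝ) : ℂ) * Complex.I by push_cast; ring,
        Complex.exp_ofReal_mul_I_re]
    have hNpos : (0 : ℝ) < N := by exact_mod_cast Nat.pos_of_ne_zero hN0
    have harccos : ∀ j : ℕ, 2 * j < N →
        Real.arccos (Real.cos (2 * Real.pi * j / N)) = 2 * Real.pi * j / N := by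
      intro j hj
      refine Real.arccos_cos (by positivity) ?_
      rw [div_le_iff₀ hNpos]
      have : (2 * j : ℝ) ≤ N := by exact_mod_cast hj.le
      nlinarith [Real.pi_pos]
    rcases lt_or_ge (2 * k) N with hkN | hkN
    · exact ⟨k, N, hkN, by rw [hcos, harccos k hkN]⟩
    · have hlt : 2 * (N - k) < N := by
        obtain ⟨m, rfl⟩ := hN
        omega
      refine ⟨N - k, N, hlt, ?_⟩
      rw [← harccos _ hlt, hcos, ← Real.cos_two_pi_sub]
      congr 2
      rw [Nat.cast_sub hk.le]
      field_simp

/-- Apart from resonance, the homogeneous recurrence has no nonzero `N`-periodic solution. -/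
theorem eq_zero_of_linOrbit_periodic {b c : ℝ} (hres : b ∉ resonantSet ∨ c ≠ 1)
    (h1 : 1 + b + c ≠ 0) {N : ℕ} (hN : Odd N) {z : ℝ × ℝ} (hz0 : linOrbit b c N z = z.1)
    (hz1 : linOrbit b c (N + 1) z = z.2) : z = 0 := by
  obtain ⟨s, hs⟩ := IsAlgClosed.exists_pow_nat_eq ((b : ℂ) ^ 2 - 4 * c) two_pos
  set l : ℂ := (-b + s) / 2 with hl
  set m : ℂ := (-b - s) / 2 with hm
  have hlr : l ^ 2 + b * l + c = 0 := by rw [hl]; linear_combination hs / 4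
  have hmr : m ^ 2 + b * m + c = 0 := by rw [hm]; linear_combination hs / 4
  have hsum : l + m = -b := by rw [hl, hm]; ring
  have hprod : l * m = c := by rw [hl, hm]; linear_combination -hs / 4
  have hstep : ∀ t : ℕ, ((linOrbit b c (t + 1) z : ℝ) : ℂ) - l * (linOrbit b c t z : ℝ) =
      m ^ t * (z.2 - l * z.1) := by
    intro t
    induction t with
    | zero => simp
    | succ t ih =>
      rw [linOrbit_add_two]
      push_cast
      rw [pow_succ]
      linear_combination m * ih - (linOrbit b c (t + 1) z : ℂ) * hsum +
        (linOrbit b c t z : ℂ) * hprod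
  have h2 : (z.2 : ℂ) - l * z.1 = 0 := by
    have h3 := hstep N
    rw [hz0, hz1] at h3
    by_contra hne
    exact pow_ne_one_of_quadratic_eq_zero hres h1 hN hmr
      (mul_right_cancel₀ hne (by rw [one_mul]; exact h3.symm))
  have hgeom : ∀ t : ℕ, ((linOrbit b c t z : ℝ) : ℂ) = l ^ t * z.1 := by
    intro t
    induction t with
    | zero => simp
    | succ t ih =>
      have := hstep t
      rw [h2, ih] at this
      rw [pow_succ]
      linear_combination this
  have h4 : (z.1 : ℂ) = 0 := by
    have h3 := hgeom N
    rw [hz0] at h3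
    by_contra hne
    exact pow_ne_one_of_quadratic_eq_zero hres h1 hN hlr
      (mul_right_cancel₀ hne (by rw [one_mul]; exact h3.symm))
  rw [h4, mul_zero, sub_zero] at h2
  exact Prod.ext (by exact_mod_cast h4) (by exact_mod_cast h2)

/-- When the periodicity conditions of the linear part are invertible, applying their inverse turns
the nonlinear ones into a sublinear perturbation of the identity of the plane. -/
theorem exists_periodic_of_nonresonant {b c : ℝ} {h : ℝ → ℝ} (hcont : Continuous h)
    (hh : Sublinear h) (hres : b ∉ resonantSet ∨ c ≠ 1) (h1 : 1 + b + c ≠ 0) {N : ℕ}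
    (hN : Odd N) :
    ∃ y : ℕ → ℝ, Function.Periodic y N ∧ IsSolution b c h y := by
  let M : ℝ × ℝ →ₗ[ℝ] ℝ × ℝ :=
    ((linOrbit b c N - linOrbit b c 0).prod (linOrbit b c (N + 1) - linOrbit b c 1)).toLinearMap
  have hM : ∀ z, M z = (linOrbit b c N z - z.1, linOrbit b c (N + 1) z - z.2) := fun z => rfl
  have hinj : Function.Injective M := by
    refine (injective_iff_map_eq_zero M).2 fun z hz => ?_
    rw [hM, Prod.mk_eq_zero] at hz
    exact eq_zero_of_linOrbit_periodic hres h1 hN (sub_eq_zero.1 hz.1) (sub_eq_zero.1 hz.2)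
  let T := (LinearEquiv.ofInjectiveEndo M hinj).symm
  have hTM : ∀ z, T (M z) = z := fun z => (LinearEquiv.ofInjectiveEndo M hinj).symm_apply_apply z
  have hTcont : Continuous T := T.toLinearMap.continuous_of_finiteDimensional
  let P : ℝ × ℝ → ℝ × ℝ := fun z => (orbit b c h z N - z.1, orbit b c h z (N + 1) - z.2)
  have hPcont : Continuous P := by
    have := continuous_orbit (b := b) (c := c) hcont N
    have := continuous_orbit (b := b) (c := c) hcont (N + 1)
    fun_prop
  have hTP : ∀ z, T (P z) = z +
      ((orbit b c h z N - linOrbit b c N z) • T (1, 0) +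
        (orbit b c h z (N + 1) - linOrbit b c (N + 1) z) • T (0, 1)) := by
    intro z
    have hPz : P z = M z + ((orbit b c h z N - linOrbit b c N z) • (1, 0) +
        (orbit b c h z (N + 1) - linOrbit b c (N + 1) z) • (0, 1)) := by
      rw [hM]
      ext <;> simp [P]
    rw [hPz, map_add, map_add, map_smul, map_smul, hTM]
  have hs0 := sublinear_orbit_sub_linOrbit (b := b) (c := c) hh N
  have hs1 := sublinear_orbit_sub_linOrbit (b := b) (c := c) hh (N + 1)
  obtain ⟨K, hK⟩ := ((hs0.const_mul (T (1, 0)).1).add (hs1.const_mul (T (0, 1)).1)) (1 / 2)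
    (by norm_num)
  obtain ⟨L, hL⟩ := ((hs0.const_mul (T (1, 0)).2).add (hs1.const_mul (T (0, 1)).2)) (1 / 2)
    (by norm_num)
  have hfst : ∀ z, |(T (P z)).1 - z.1| ≤ 1 / 2 * ‖z‖ + K := by
    intro z
    refine le_trans (le_of_eq ?_) (hK z)
    rw [hTP]
    congr 1
    simp only [Prod.fst_add, Prod.smul_fst, smul_eq_mul]
    ring
  have hsnd : ∀ z, |(T (P z)).2 - z.2| ≤ 1 / 2 * ‖z‖ + L := by
    intro z
    refine le_trans (le_of_eq ?_) (hL z)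
    rw [hTP]
    congr 1
    simp only [Prod.snd_add, Prod.smul_snd, smul_eq_mul]
    ring
  -- On the boundary of the square of half-side `ρ` the deviation `ρ / 2 + max K L` is below `ρ`.
  let ρ : ℝ := 2 * (|K| + |L| + 1)
  have hρ : 0 < ρ := by positivity
  have hKρ : 1 / 2 * ρ + K < ρ := by
    change 1 / 2 * (2 * (|K| + |L| + 1)) + K < 2 * (|K| + |L| + 1)
    linarith [le_abs_self K, abs_nonneg L]
  have hLρ : 1 / 2 * ρ + L < ρ := by
    change 1 / 2 * (2 * (|K| + |L| + 1)) + L < 2 * (|K| + |L| + 1)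
    linarith [le_abs_self L, abs_nonneg K]
  have hnorm : ∀ {x y : ℝ}, x ∈ Set.Icc (-ρ) ρ → y ∈ Set.Icc (-ρ) ρ → ‖(x, y)‖ ≤ ρ :=
    fun hx hy => max_le (abs_le.2 hx) (abs_le.2 hy)
  have hmem : ρ ∈ Set.Icc (-ρ) ρ := ⟨by linarith, le_rfl⟩
  have hmem' : -ρ ∈ Set.Icc (-ρ) ρ := ⟨le_rfl, by linarith⟩
  obtain ⟨z, hz0, hz1⟩ := exists_common_zero_of_sign_change hρ hρ
    (f := fun z => (T (P z)).1) (g := fun z => (T (P z)).2) (by fun_prop) (by fun_prop)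
    (fun y hy => by linarith [(abs_le.1 (hfst (ρ, y))).1, hnorm hmem hy])
    (fun y hy => by linarith [(abs_le.1 (hfst (-ρ, y))).2, hnorm hmem' hy])
    (fun x hx => by linarith [(abs_le.1 (hsnd (x, ρ))).1, hnorm hx hmem])
    (fun x hx => by linarith [(abs_le.1 (hsnd (x, -ρ))).2, hnorm hx hmem'])
  have hPz : P z = 0 := (LinearEquiv.map_eq_zero_iff T).1 (Prod.ext hz0 hz1)
  rw [Prod.mk_eq_zero] at hPz
  exact ⟨orbit b c h z, periodic_orbit (sub_eq_zero.1 hPz.1) (sub_eq_zero.1 hPz.2),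
    isSolution_orbit z⟩

/-! ### The resonant case -/

/-- If `1 + b + c = 0`, then `y (t + 1) - c y t` increases by `h (y t)` at each step. -/
theorem orbit_sub_mul_eq_add_sum {b c : ℝ} (hbc : 1 + b + c = 0) (h : ℝ → ℝ) (z : ℝ × ℝ) (t : ℕ) :
    orbit b c h z (t + 1) - c * orbit b c h z t =
      z.2 - c * z.1 + ∑ i ∈ Finset.range t, h (orbit b c h z i) := by
  induction t with
  | zero => simp
  | succ t ih =>
    rw [Finset.sum_range_succ, ← add_assoc, ← ih, orbit_add_two]
    linear_combination -orbit b c h z (t + 1) * hbc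

theorem linOrbit_of_resonant {b c : ℝ} (hbc : 1 + b + c = 0) (z : ℝ × ℝ) (t : ℕ) :
    linOrbit b c t z = z.1 + (∑ i ∈ Finset.range t, c ^ i) * (z.2 - z.1) := by
  induction t using Nat.twoStepInduction with
  | zero => simp
  | one => simp
  | more t ih0 ih1 =>
    rw [linOrbit_add_two, ih0, ih1, Finset.sum_range_succ _ (t + 1), Finset.sum_range_succ,
      pow_succ]
    have hb : b = -1 - c := by linarith
    rw [hb]
    ring

/-- In the resonant case the constants solve the homogeneous recurrence. With `u = y 0` and
`v = y 1 - y 0`, up to sublinear terms `y t` is `u + (1 + c + ⋯ + c ^ (t - 1)) v`. On a rectangle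
`|u| ≤ ρ`, `|v| ≤ δ ρ` with `δ` small and `ρ` large, the sum of the `h (y t)` therefore has the sign
of `u` when `|u| = ρ`, and `y N - y 0` has the sign of `v` when `|v| = δ ρ`. -/
theorem exists_periodic_of_resonant {b c : ℝ} {h : ℝ → ℝ} (hcont : Continuous h)
    (hh : Sublinear h) {R : ℝ} (hR : 0 < R) (hsign : ∀ x : ℝ, R < |x| → 0 < x * h x)
    (hbc : 1 + b + c = 0) {N : ℕ} (hN : Odd N) :
    ∃ y : ℕ → ℝ, Function.Periodic y N ∧ IsSolution b c h y := by
  let S : ℕ → ℝ := fun t => ∑ i ∈ Finset.range t, c ^ i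
  have hSN : 0 < S N := hN.geom_sum_pos
  obtain ⟨C, hC, hSC⟩ : ∃ C : ℝ, 1 ≤ C ∧ ∀ t ≤ N, |S t| ≤ C := by
    refine ⟨1 + ∑ t ∈ Finset.range (N + 1), |S t|,
      le_add_of_nonneg_right (Finset.sum_nonneg fun _ _ => abs_nonneg _), fun t ht => ?_⟩
    have := Finset.single_le_sum (f := fun t => |S t|) (fun _ _ => abs_nonneg _)
      (Finset.mem_range.2 (Nat.lt_succ_of_le ht))
    linarith
  let δ : ℝ := 1 / (4 * C)
  have hδ : 0 < δ := by positivity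
  have hCδ : C * δ = 1 / 4 := by
    simp only [δ]
    field_simp
  have hδ1 : δ ≤ 1 := by nlinarith
  let ε : ℝ := min (1 / 8) (S N * δ / 4)
  have hε : 0 < ε := lt_min (by norm_num) (by positivity)
  have hε1 : ε ≤ 1 / 8 := min_le_left _ _
  have hε2 : ε ≤ S N * δ / 4 := min_le_right _ _
  choose K₀ hK₀ using fun t => sublinear_orbit_sub_linOrbit (b := b) (c := c) hh t ε hε
  obtain ⟨K, hK, hK₀K⟩ : ∃ K : ℝ, 0 ≤ K ∧ ∀ t ≤ N, K₀ t ≤ K := by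
    refine ⟨∑ t ∈ Finset.range (N + 1), |K₀ t|, Finset.sum_nonneg fun _ _ => abs_nonneg _,
      fun t ht => (le_abs_self _).trans ?_⟩
    exact Finset.single_le_sum (f := fun t => |K₀ t|) (fun _ _ => abs_nonneg _)
      (Finset.mem_range.2 (Nat.lt_succ_of_le ht))
  let ρ : ℝ := 2 * (K + R) + 2 * K / (S N * δ) + 1
  have hρ1 : 2 * (K + R) < ρ := by
    have : 0 ≤ 2 * K / (S N * δ) := by positivity
    simp only [ρ]
    linarith
  have hρ2 : 2 * K < ρ * (S N * δ) := by
    rw [← div_lt_iff₀ (by positivity)]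
    simp only [ρ]
    linarith
  have hρ : 0 < ρ := by linarith
  let Y : ℕ → ℝ × ℝ → ℝ := fun t p => orbit b c h (p.1, p.1 + p.2) t
  have hY : ∀ t ≤ N, ∀ u ∈ Set.Icc (-ρ) ρ, ∀ v ∈ Set.Icc (-(δ * ρ)) (δ * ρ),
      |Y t (u, v) - u - S t * v| ≤ 2 * ε * ρ + K := by
    intro t ht u hu v hv
    have h1 := hK₀ t (u, u + v)
    have hδρ : δ * ρ ≤ ρ := mul_le_of_le_one_left hρ.le hδ1
    have h2 : ‖(u, u + v)‖ ≤ 2 * ρ :=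
      max_le (abs_le.2 ⟨by linarith [hu.1], by linarith [hu.2]⟩)
        (abs_le.2 ⟨by linarith [hu.1, hv.1], by linarith [hu.2, hv.2]⟩)
    simp only [linOrbit_of_resonant hbc, add_sub_cancel_left] at h1
    calc |Y t (u, v) - u - S t * v|
        = |orbit b c h (u, u + v) t - (u + (∑ i ∈ Finset.range t, c ^ i) * v)| := by
          rw [sub_sub]
      _ ≤ ε * ‖(u, u + v)‖ + K₀ t := h1
      _ ≤ ε * (2 * ρ) + K := by
        gcongr
        exact hK₀K t ht
      _ = 2 * ε * ρ + K := by ring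
  have hclose : ∀ t ≤ N, ∀ u ∈ Set.Icc (-ρ) ρ, ∀ v ∈ Set.Icc (-(δ * ρ)) (δ * ρ),
      |Y t (u, v) - u| < ρ - R := by
    intro t ht u hu v hv
    have h1 := hY t ht u hu v hv
    have h2 : |S t * v| ≤ 1 / 4 * ρ := by
      rw [abs_mul, ← hCδ, mul_assoc]
      exact mul_le_mul (hSC t ht) (abs_le.2 hv) (abs_nonneg _) (by linarith)
    have h3 := abs_add_le (Y t (u, v) - u - S t * v) (S t * v)
    rw [sub_add_cancel] at h3
    have h4 : ε * ρ ≤ 1 / 8 * ρ := by gcongr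
    linarith
  have hpos : ∀ x, R < x → 0 < h x := fun x hx =>
    pos_of_mul_pos_right (hsign x (hx.trans_le (le_abs_self x))) (hR.trans hx).le
  have hneg : ∀ x, x < -R → h x < 0 := fun x hx => by
    have := hsign x (by linarith [neg_le_abs x])
    exact neg_of_mul_pos_right this (by linarith)
  have hNne : (Finset.range N).Nonempty := Finset.nonempty_range_iff.2 hN.pos.ne'
  have hYcont : ∀ t, Continuous (Y t) := fun t =>
    (continuous_orbit hcont t).comp (by fun_prop)
  have hmem : ρ ∈ Set.Icc (-ρ) ρ := ⟨by linarith, le_rfl⟩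
  have hmem' : -ρ ∈ Set.Icc (-ρ) ρ := ⟨le_rfl, by linarith⟩
  have hδρ : 0 < δ * ρ := by positivity
  have hvert : S N * (δ * ρ) > 2 * ε * ρ + K := by
    have : ε * ρ ≤ S N * δ / 4 * ρ := by gcongr
    linarith
  obtain ⟨⟨u, v⟩, hsum, hper⟩ := exists_common_zero_of_sign_change hρ hδρ
    (f := fun p => ∑ t ∈ Finset.range N, h (Y t p)) (g := fun p => Y N p - p.1)
    (by fun_prop) (by fun_prop)
    (fun v hv => Finset.sum_pos (fun t ht => hpos _ (by
      linarith [(abs_lt.1 (hclose t (Finset.mem_range.1 ht).le ρ hmem v hv)).1])) hNne)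
    (fun v hv => Finset.sum_neg (fun t ht => hneg _ (by
      linarith [(abs_lt.1 (hclose t (Finset.mem_range.1 ht).le (-ρ) hmem' v hv)).2])) hNne)
    (fun u hu => by
      linarith [(abs_le.1 (hY N le_rfl u hu (δ * ρ) ⟨by linarith, le_rfl⟩)).1])
    (fun u hu => by
      linarith [(abs_le.1 (hY N le_rfl u hu (-(δ * ρ)) ⟨le_rfl, by linarith⟩)).2])
  have h0 : orbit b c h (u, u + v) N = u := sub_eq_zero.1 hper
  refine ⟨orbit b c h (u, u + v), periodic_orbit h0 ?_, isSolution_orbit _⟩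
  have h1 := orbit_sub_mul_eq_add_sum hbc h (u, u + v) N
  rw [h0, show ∑ i ∈ Finset.range N, h (orbit b c h (u, u + v) i) = 0 from hsum, add_zero] at h1
  exact sub_left_injective h1

end PeriodicDifference

theorem corollary3p3 (b c : ℝ) (hc : c ≠ 0) (h : ℝ → ℝ) (hcont : Continuous h)
    (hgrowth : Filter.Tendsto (fun r : ℝ => PeriodicDifference.supAbs h (2 * r) / r)
      Filter.atTop (nhds 0))
    (hsign : ∃ R : ℝ, 0 < R ∧ ∀ x : ℝ, R < |x| → 0 < x * h x)
    (hres : b ∉ PeriodicDifference.resonantSet ∨ c ≠ 1) :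
    ∀ N : ℕ, Odd N → 1 < N →
      ∃ y : ℕ → ℝ, Function.Periodic y N ∧ PeriodicDifference.IsSolution b c h y := by
  intro N hN _
  have hh := PeriodicDifference.sublinear_of_tendsto_supAbs hcont hgrowth
  by_cases hbc : 1 + b + c = 0
  · obtain ⟨R, hR, hsign⟩ := hsign
    exact PeriodicDifference.exists_periodic_of_resonant hcont hh hR hsign hbc hN
  · exact PeriodicDifference.exists_periodic_of_nonresonant hcont hh hres hbc hN
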